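/- **The calculus $\lambda_{[]}$.** Types over a set of base types $\tau$: $T ::= \tau \mid S\to T\mid[\vec S]T$. Terms, taken up to renaming of bound variables: $M ::= x \mid \lambda x{:}T.M \mid MN \mid \mathsf{quo}\langle\Gamma\rangle M \mid \mathsf{unq}_n\langle\vec N\rangle M$ with $n\ge 0$, where contexts $\Gamma=x_1{:}T_1,\dots,x_k{:}T_k$ have distinct variables, type and term sequences are finite, and $\mathsf{quo}\langle\Gamma\rangle$ binds the variables of $\Gamma$. A context stack is a finite sequence $\Psi=\Gamma_m;\dots;\Gamma_1$ of contexts; $\Gamma_l$ is its level $l$. Typing: - $\Psi;\Gamma\vdash x:T$ if $x{:}T\in\Gamma$; - $\Psi;\Gamma\vdash\lambda x{:}T.M:T\to S$ if $\Psi;\Gamma,x{:}T\vdash M:S$; - $\Psi;\Gamma\vdash MN:S$ if $\Psi;\Gamma\vdash M:T\to S$ and $\Psi;\Gamma\vdash N:T$; - $\Psi\vdash\mathsf{quo}\langle\Gamma\rangle M:[T_1,\dots,T_k]T$ if $\Psi;\Gamma\vdash M:T$ and $\Gamma=x_1{:}T_1,\dots,x_k{:}T_k$; - $\Psi;\Gamma_n;\dots;\Gamma_1\vdash\mathsf{unq}_n\langle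 N_1,\dots,N_k\rangle M:S$ if $\Psi\vdash M:[T_1,\dots,T_k]S$ and $\Psi;\Gamma_n;\dots;\Gamma_1\vdash N_i:T_i$ for all $i$, where $n=1$ in variant K, $n\in\{0,1\}$ in variant T, $n\ge1$ in variant K4, and $n\ge0$ in variant S4. A term is *well typed* in a variant if $\Psi\vdash M:T$ holds in it for some $\Psi$ and $T$. It is *well scoped* if for some context stack each of its variables occurs in the innermost context at its position and each $\mathsf{unq}_n$ has at least $n$ contexts to remove, where $\lambda x$ adds $x$ to the innermost context (which must exist), $\mathsf{quo}\langle\Gamma\rangle$ pushes $\Gamma$, and the body $M$ of $\mathsf{unq}_n\langle\vec N\rangle M$ is read with the $n$ innermost contexts removed. Every well-typed term is well scoped. For $l\ge1$, the capture-avoiding substitution $M[\sigma]_l$ replaces the level-$l$ free variables of $M$: it acts on variables when $l=1$; it commutes with $\lambda$ and application; it becomes $[\sigma]_{l+1}$ under $\mathsf{quo}$; on $\mathsf{unq}_k\langle\vec N\rangle M$ it acts on $\vec N$ by $[\sigma]_l$, and on $M$ by $[\sigma]_{l-k}$ if $l>k$ and not at all if $l\le k$. The level substitution $M\uparrow^n_l$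 fixes variables, commutes with $\lambda$ and application, becomes $\uparrow^n_{l+1}$ under $\mathsf{quo}$, and sends $\mathsf{unq}_k\langle\vec N\rangle M$ to $\mathsf{unq}_{k+n-1}\langle\vec N\uparrow^n_l\rangle M$ if $l\le k$ and to $\mathsf{unq}_k\langle\vec N\uparrow^n_l\rangle(M\uparrow^n_{l-k})$ if $l>k$; bound variables are renamed wherever merging two contexts would cause a clash of names. $\beta$-reduction $\to_\beta$ is the closure under all term constructors of $$(\lambda x{:}T.M)N\to_\beta M[N/x]_1,\qquad \mathsf{unq}_n\langle\vec N\rangle(\mathsf{quo}\langle\Gamma\rangle M)\to_\beta M\uparrow^n_1[\vec N/\Gamma]_1\ \text{ when } |\vec N|=|\Gamma|.$$ **Theorem.** 1. (Strong normalization) In each of the variants K, T, K4, S4, no infinite $\to_\beta$-sequence starts from a well-typed term. 2. (Weak confluence) If $M$ is well scoped (in particular, if it is well typed in one of the variants), $M\to_\beta N_1$ and $M\to_\beta N_2$, then there is $L$ with $N_1\to_\beta^*L$ and $N_2\to_\beta^*L$. 3. (Confluence) If $M$ is well scoped (in particular, if it is well typed in one of the variants), $M\to_\beta^*N_1$ and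 $M\to_\beta^*N_2$, then there is $L$ with $N_1\to_\beta^*L$ and $N_2\to_\beta^*L$. -/

import Mathlib

namespace FitchContextual

universe u

/-- Types over a set `B` of base types: base types, function types `S → T`, and contextual modal
types `[S₀, …, Sₖ₋₁] T`. Finite sequences are tuples `Fin k → _`. -/
inductive Ty (B : Type u) : Type u
  | base (b : B) : Ty B
  | arrow (S T : Ty B) : Ty B
  | box {k : ℕ} (S : Fin k → Ty B) (T : Ty B) : Ty B

/-- Terms modulo renaming of bound variables, in de Bruijn form. A variable always refers to the
innermost context of the context stack (level 1), and `var x` is the `x`-th entry of that context.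
`lam T M` is `λ x : T. M` and extends the innermost context by a new entry at index `0`.
`quo Δ M` is the quotation of `M` under the context `Δ`: it pushes `Δ` as a new innermost context,
whose `i`-th entry is `Δ i`. `unq n M N` is the level-`n` unquotation of `M` with the term
sequence `N`: `N` lives in the current stack, and `M` in the stack without its `n` innermost
contexts. -/
inductive Tm (B : Type u) : Type u
  | var (x : ℕ) : Tm B
  | lam (T : Ty B) (M : Tm B) : Tm B
  | app (M N : Tm B) : Tm B
  | quo {k : ℕ} (Δ : Fin k → Ty B) (M : Tm B) : Tm B
  | unq {k : ℕ} (n : ℕ) (M : Tm B) (N : Fin k → Tm B) : Tm B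

/-- Contexts (the entry at index `0` is the most recent one). -/
abbrev Ctx (B : Type u) := List (Ty B)

/-- Context stacks; the head is the innermost context, i.e. level 1. -/
abbrev Stack (B : Type u) := List (Ctx B)

/-- The four variants of the calculus. -/
inductive Variant
  | K | T | K4 | S4

/-- The unquotation levels that a variant allows. -/
def Variant.Allows : Variant → ℕ → Prop
  | .K, n => n = 1
  | .T, n => n = 0 ∨ n = 1
  | .K4, n => 1 ≤ n
  | .S4, _ => True

/-- `HasType A Ψ M T` is the typing judgment `Ψ ⊢ M : T` of variant `A`. In the rule for
unquotation the stack is `Φ = Ψ; Γₙ; …; Γ₁`, so that `Φ.drop n = Ψ`. -/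
inductive HasType {B : Type u} (A : Variant) : Stack B → Tm B → Ty B → Prop
  | var {Ψ : Stack B} {Γ : Ctx B} {x : ℕ} {T : Ty B} :
      Γ[x]? = some T → HasType A (Γ :: Ψ) (.var x) T
  | lam {Ψ : Stack B} {Γ : Ctx B} {M : Tm B} {S T : Ty B} :
      HasType A ((T :: Γ) :: Ψ) M S → HasType A (Γ :: Ψ) (.lam T M) (.arrow T S)
  | app {Ψ : Stack B} {Γ : Ctx B} {M N : Tm B} {S T : Ty B} :
      HasType A (Γ :: Ψ) M (.arrow T S) → HasType A (Γ :: Ψ) N T →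
      HasType A (Γ :: Ψ) (.app M N) S
  | quo {Ψ : Stack B} {k : ℕ} {Δ : Fin k → Ty B} {M : Tm B} {T : Ty B} :
      HasType A (List.ofFn Δ :: Ψ) M T → HasType A Ψ (.quo Δ M) (.box Δ T)
  | unq {Φ : Stack B} {n k : ℕ} {M : Tm B} {N : Fin k → Tm B} {T : Fin k → Ty B} {S : Ty B} :
      A.Allows n → n ≤ Φ.length → HasType A (Φ.drop n) M (.box T S) →
      (∀ i, HasType A Φ (N i) (T i)) → HasType A Φ (.unq n M N) S

/-- `Scoped s M`: every variable of `M` is an entry of the context that it refers to, where `s`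
lists the lengths of the contexts of the surrounding stack (innermost first). No typing is
involved. -/
inductive Scoped {B : Type u} : List ℕ → Tm B → Prop
  | var {s : List ℕ} {g x : ℕ} : x < g → Scoped (g :: s) (.var x)
  | lam {s : List ℕ} {g : ℕ} {T : Ty B} {M : Tm B} :
      Scoped ((g + 1) :: s) M → Scoped (g :: s) (.lam T M)
  | app {s : List ℕ} {M N : Tm B} : Scoped s M → Scoped s N → Scoped s (.app M N)
  | quo {s : List ℕ} {k : ℕ} {Δ : Fin k → Ty B} {M : Tm B} :
      Scoped (k :: s) M → Scoped s (.quo Δ M)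
  | unq {s : List ℕ} {n k : ℕ} {M : Tm B} {N : Fin k → Tm B} :
      n ≤ s.length → Scoped (s.drop n) M → (∀ i, Scoped s (N i)) → Scoped s (.unq n M N)

/-- Well-typed terms are well scoped. -/
theorem HasType.scoped {B : Type u} {A : Variant} {Ψ : Stack B} {M : Tm B} {T : Ty B}
    (h : HasType A Ψ M T) : Scoped (Ψ.map List.length) M := by
  induction h with
  | var h => exact .var (List.getElem?_eq_some_iff.1 h).1
  | lam _ ih => exact .lam ih
  | app _ _ ih₁ ih₂ => exact .app ih₁ ih₂
  | quo _ ih => exact .quo (by simpa using ih)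
  | unq _ hn _ _ ih₁ ih₂ =>
      exact .unq (by simpa using hn) (by simpa [List.map_drop] using ih₁) ih₂

/-- Extension of a renaming under a binder of the innermost context. -/
def liftRen (ρ : ℕ → ℕ) : ℕ → ℕ
  | 0 => 0
  | x + 1 => ρ x + 1

/-- `M.rename l ρ` renames the level-`l` free variables of `M` by `ρ` (for `l ≥ 1`). -/
def Tm.rename {B : Type u} (l : ℕ) (ρ : ℕ → ℕ) : Tm B → Tm B
  | .var x => if l = 1 then .var (ρ x) else .var x
  | .lam T M => .lam T (M.rename l (if l = 1 then liftRen ρ else ρ))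
  | .app M N => .app (M.rename l ρ) (N.rename l ρ)
  | .quo Δ M => .quo Δ (M.rename (l + 1) ρ)
  | .unq n M N =>
      .unq n (if l ≤ n then M else M.rename (l - n) ρ) (fun i => (N i).rename l ρ)

/-- Extension of a substitution under a binder of the innermost context. -/
def liftSub {B : Type u} (σ : ℕ → Tm B) : ℕ → Tm B
  | 0 => .var 0
  | x + 1 => (σ x).rename 1 Nat.succ

/-- The substitution `M[σ]ₗ`, which replaces simultaneously the level-`l` free variables of `M`
by the terms `σ` (for `l ≥ 1`). A term of `σ` is inserted where the level has become `1`, so it is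
only the crossing of a `λ` at level `1` that affects it. -/
def Tm.subst {B : Type u} (l : ℕ) (σ : ℕ → Tm B) : Tm B → Tm B
  | .var x => if l = 1 then σ x else .var x
  | .lam T M => .lam T (M.subst l (if l = 1 then liftSub σ else σ))
  | .app M N => .app (M.subst l σ) (N.subst l σ)
  | .quo Δ M => .quo Δ (M.subst (l + 1) σ)
  | .unq n M N =>
      .unq n (if l ≤ n then M else M.subst (l - n) σ) (fun i => (N i).subst l σ)

/-- The content `N / Δ` of the substitution that replaces the `k` most recent entries of a context
by the `k` terms `N` and keeps the remaining entries. -/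
def inst {B : Type u} {k : ℕ} (N : Fin k → Tm B) (x : ℕ) : Tm B :=
  if h : x < k then N ⟨x, h⟩ else .var (x - k)

/-- The level substitution `M ↑ⁿₗ` (for `l ≥ 1`), which takes a term over the stack
`Ψ; Γ₀; Δ₁; …; Δₗ` to a term over `Ψ; Γ₀; …; (Γₙ, Δ₁); …; Δₗ`, where `d` is the length of `Δ₁`.
For `n ≥ 1` the number `d` plays no role and no variable changes. For `n = 0` the contexts `Γ₀`
and `Δ₁` are concatenated, so that the subterms living in `Ψ; Γ₀` have to skip the `d` entries of
`Δ₁`; with named variables this is the requirement that `Γ₀` and `Δ₁` have disjoint domains. -/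
def Tm.lev {B : Type u} (n : ℕ) (l d : ℕ) : Tm B → Tm B
  | .var x => .var x
  | .lam T M => .lam T (M.lev n l (if l = 1 then d + 1 else d))
  | .app M N => .app (M.lev n l d) (N.lev n l d)
  | .quo Δ M => .quo Δ (M.lev n (l + 1) d)
  | .unq k M N =>
      if l ≤ k then
        .unq (k + n - 1) (if n = 0 ∧ k = l then M.rename 1 (· + d) else M)
          (fun i => (N i).lev n l d)
      else .unq k (M.lev n (l - k) d) (fun i => (N i).lev n l d)

/-- `β`-reduction: the closure of the two `β`-rules under the congruence rules. The second rule
applies only when the term sequence is as long as the context of the quotation. -/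
inductive Step {B : Type u} : Tm B → Tm B → Prop
  | beta (T : Ty B) (M N : Tm B) :
      Step (.app (.lam T M) N) (M.subst 1 (inst fun _ : Fin 1 => N))
  | unquote {k : ℕ} (n : ℕ) (Δ : Fin k → Ty B) (M : Tm B) (N : Fin k → Tm B) :
      Step (.unq n (.quo Δ M) N) ((M.lev n 1 k).subst 1 (inst N))
  | lam (T : Ty B) {M M' : Tm B} : Step M M' → Step (.lam T M) (.lam T M')
  | appL {M M' : Tm B} (N : Tm B) : Step M M' → Step (.app M N) (.app M' N)
  | appR (M : Tm B) {N N' : Tm B} : Step N N' → Step (.app M N) (.app M N')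
  | quo {k : ℕ} (Δ : Fin k → Ty B) {M M' : Tm B} : Step M M' → Step (.quo Δ M) (.quo Δ M')
  | unqL {k : ℕ} (n : ℕ) {M M' : Tm B} (N : Fin k → Tm B) :
      Step M M' → Step (.unq n M N) (.unq n M' N)
  | unqR {k : ℕ} (n : ℕ) (M : Tm B) (N : Fin k → Tm B) (i : Fin k) {L : Tm B} :
      Step (N i) L → Step (.unq n M N) (.unq n M (Function.update N i L))

/-- Many-step `β`-reduction. -/
abbrev Steps {B : Type u} : Tm B → Tm B → Prop := Relation.ReflTransGen Step

/-- There is no infinite reduction sequence that starts from `M`. -/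
def StronglyNormalizing {B : Type u} (M : Tm B) : Prop :=
  ¬ ∃ f : ℕ → Tm B, f 0 = M ∧ ∀ i, Step (f i) (f (i + 1))

/-- Any two one-step reducts of `M` have a common many-step reduct. -/
def WeaklyConfluent {B : Type u} (M : Tm B) : Prop :=
  ∀ N₁ N₂, Step M N₁ → Step M N₂ → ∃ L, Steps N₁ L ∧ Steps N₂ L

/-- Any two many-step reducts of `M` have a common many-step reduct. -/
def Confluent {B : Type u} (M : Tm B) : Prop :=
  ∀ N₁ N₂, Steps M N₁ → Steps M N₂ → ∃ L, Steps N₁ L ∧ Steps N₂ L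

end FitchContextual

namespace FitchContextual

universe u

variable {B : Type u}

/-! Substitution and level substitution are special cases of one operation, a simultaneous
substitution `KSub` for a whole context stack. It assigns a term to each variable of each level and
carries a monotone map `o` of levels, under which `unq n` becomes `unq (o n)`. These substitutions
compose (`Tm.ksub_ksub`), and the contracta of both β-rules are instances
(`Tm.subst_one_eq_ksub_plug`, `Tm.lev_subst_eq_ksub_plug`), so the composition law supplies all
commutation facts.

On ill-scoped terms the unquotation rule is not stable under substitution: a variable beyond the
quoted context escapes into the surrounding one. `KStep` sends such variables to a closed term
instead. It is stable under substitution, preserves scoping and contains every `Step` from a scoped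
term.

Strong normalization is Tait's method with candidates that mention neither stacks nor typing: `M` is
reducible at a box type if `unq n M N` is reducible for every `n` and all reducible `N`. Since every
`n` is allowed, one argument covers all four variants. The fundamental lemma `HasType.red` shows
that reducible stack substitutions make typed terms reducible.

Confluence follows from parallel reduction: every term has a complete development
(`Par.exists_development`), which gives the diamond property. Weak confluence is the special case of
single steps. -/

/-- Monotone maps of levels that fix `0`. The value at `n` is the number of contexts that are
removed from the target stack when `n` contexts are removed from the source stack. -/
@[ext] structure LevelMap where
  toFun : ℕ → ℕ
  map_zero : toFun 0 = 0
  mono : Monotone toFun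

/-! ### Algebra of level maps -/

namespace LevelMap

instance : CoeFun LevelMap fun _ => ℕ → ℕ := ⟨toFun⟩

/-- The identity. -/
def refl : LevelMap := ⟨fun n => n, rfl, fun _ _ h => h⟩

/-- The map between the stacks without the `n` innermost source contexts. -/
def drop (o : LevelMap) (n : ℕ) : LevelMap :=
  ⟨fun m => o (n + m) - o n, by simp, fun _ _ h => Nat.sub_le_sub_right (o.mono (by omega)) _⟩

/-- The map between the stacks with a new innermost context on both sides. -/
def push (o : LevelMap) : LevelMap where
  toFun
    | 0 => 0
    | n + 1 => o n + 1
  map_zero := rfl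
  mono := monotone_nat_of_le_succ fun n => by
    cases n with
    | zero => exact Nat.zero_le _
    | succ n => exact Nat.succ_le_succ (o.mono (Nat.le_succ n))

/-- Composition, first `o` and then `p`. -/
def comp (o p : LevelMap) : LevelMap :=
  ⟨fun n => p (o n), by simp [o.map_zero, p.map_zero], fun _ _ h => p.mono (o.mono h)⟩

/-- The map that replaces the innermost context by `n` contexts. -/
def plug (n : ℕ) : LevelMap where
  toFun
    | 0 => 0
    | m + 1 => m + n
  map_zero := rfl
  mono := monotone_nat_of_le_succ fun m => by
    cases m with
    | zero => exact Nat.zero_le _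
    | succ m => exact Nat.add_le_add_right (Nat.le_succ m) n

@[simp] theorem refl_apply (n : ℕ) : refl n = n := rfl

@[simp] theorem apply_zero (o : LevelMap) : o 0 = 0 := o.map_zero

@[simp] theorem drop_apply (o : LevelMap) (n m : ℕ) : o.drop n m = o (n + m) - o n := rfl

@[simp] theorem push_succ (o : LevelMap) (n : ℕ) : o.push (n + 1) = o n + 1 := rfl

@[simp] theorem comp_apply (o p : LevelMap) (n : ℕ) : o.comp p n = p (o n) := rfl

@[simp] theorem plug_succ (n m : ℕ) : plug n (m + 1) = m + n := rfl

/-- This makes the truncated subtraction in `drop` exact. -/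
theorem le_add (o : LevelMap) (n m : ℕ) : o n ≤ o (n + m) := o.mono (Nat.le_add_right n m)

theorem funExt {o p : LevelMap} (h : ∀ n, o n = p n) : o = p := LevelMap.ext (funext h)

@[simp] theorem drop_zero (o : LevelMap) : o.drop 0 = o := funExt fun n => by simp

@[simp] theorem refl_drop (n : ℕ) : refl.drop n = refl := funExt fun m => by simp

@[simp] theorem refl_push : refl.push = refl := funExt fun m => by cases m <;> simp

@[simp] theorem plug_drop_succ (n m : ℕ) : (plug n).drop (m + 1) = refl :=
  funExt fun i => by
    have : m + 1 + i = m + i + 1 := by omega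
    simp only [drop_apply, this, plug_succ, refl_apply]
    omega

theorem plug_one : plug 1 = refl := funExt fun m => by cases m <;> simp

theorem drop_comp (o p : LevelMap) (n : ℕ) :
    (o.drop n).comp (p.drop (o n)) = (o.comp p).drop n :=
  funExt fun m => by
    have := o.le_add n m
    simp [show o n + (o (n + m) - o n) = o (n + m) by omega]

end LevelMap

/-! ### Renamings of all levels of a stack -/

/-- Renamings of the contexts of a stack; level `l` of the stack has index `l - 1`. -/
abbrev Ren := ℕ → ℕ → ℕ

/-- Extension under a binder of the innermost context. -/
def Ren.lam (ρ : Ren) : Ren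
  | 0 => liftRen (ρ 0)
  | j + 1 => ρ (j + 1)

/-- Extension under a quotation. -/
def Ren.push (ρ : Ren) : Ren
  | 0 => id
  | j + 1 => ρ j

/-- The weakening of the innermost context by one entry. -/
def Ren.wk : Ren
  | 0 => Nat.succ
  | _ + 1 => id

/-- Renaming of all free variables. -/
def Tm.ren : Tm B → Ren → Tm B
  | .var x, ρ => .var (ρ 0 x)
  | .lam T M, ρ => .lam T (M.ren ρ.lam)
  | .app M N, ρ => .app (M.ren ρ) (N.ren ρ)
  | .quo Δ M, ρ => .quo Δ (M.ren ρ.push)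
  | .unq n M N, ρ => .unq n (M.ren fun j => ρ (n + j)) fun i => (N i).ren ρ

theorem Tm.ren_ren (M : Tm B) (ρ ρ' : Ren) :
    (M.ren ρ).ren ρ' = M.ren fun j x => ρ' j (ρ j x) := by
  induction M generalizing ρ ρ' with
  | var x => rfl
  | lam T M ih =>
    simp only [ren, ih]
    congr 2
    funext j x
    rcases j with _ | j
    · cases x <;> rfl
    · rfl
  | app M N ih₁ ih₂ => simp only [ren, ih₁, ih₂]
  | quo Δ M ih =>
    simp only [ren, ih]
    congr 2
    funext j x
    cases j <;> rfl
  | unq n M N ih₁ ih₂ => simp only [ren, ih₁, ih₂]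

/-! ### Substitutions of all levels of a stack -/

/-- Simultaneous substitutions for a whole context stack, together with a level transformation.
The terms for the variables of level `j + 1` live in the target stack without its `off j` innermost
contexts. -/
@[ext] structure KSub (B : Type u) where
  sub : ℕ → ℕ → Tm B
  off : LevelMap

namespace KSub

/-- Extension under a binder of the innermost context. -/
def lam (κ : KSub B) : KSub B where
  sub
    | 0, 0 => .var 0
    | 0, x + 1 => (κ.sub 0 x).ren .wk
    | j + 1, x => if κ.off (j + 1) = 0 then (κ.sub (j + 1) x).ren .wk else κ.sub (j + 1) x
  off := κ.off

/-- Extension under a quotation. -/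
def push (κ : KSub B) : KSub B where
  sub
    | 0, x => .var x
    | j + 1, x => κ.sub j x
  off := κ.off.push

/-- Restriction to the stack without its `n` innermost contexts. -/
def drop (κ : KSub B) (n : ℕ) : KSub B := ⟨fun j => κ.sub (n + j), κ.off.drop n⟩

/-- The identity. -/
def refl : KSub B := ⟨fun _ => .var, .refl⟩

/-- The substitution of `τ` for the innermost context, which is replaced by `n` contexts. -/
def plug (n : ℕ) (τ : ℕ → Tm B) : KSub B where
  sub
    | 0, x => τ x
    | _ + 1, x => .var x
  off := .plug n

@[simp] theorem lam_off (κ : KSub B) : κ.lam.off = κ.off := rfl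
theorem lam_sub_succ (κ : KSub B) (j x : ℕ) : κ.lam.sub (j + 1) x =
    if κ.off (j + 1) = 0 then (κ.sub (j + 1) x).ren .wk else κ.sub (j + 1) x := rfl
@[simp] theorem push_off (κ : KSub B) : κ.push.off = κ.off.push := rfl
@[simp] theorem push_sub_zero (κ : KSub B) (x : ℕ) : κ.push.sub 0 x = .var x := rfl
@[simp] theorem push_sub_succ (κ : KSub B) (j x : ℕ) : κ.push.sub (j + 1) x = κ.sub j x := rfl
@[simp] theorem drop_off (κ : KSub B) (n : ℕ) : (κ.drop n).off = κ.off.drop n := rfl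
@[simp] theorem drop_sub (κ : KSub B) (n j : ℕ) : (κ.drop n).sub j = κ.sub (n + j) := rfl
@[simp] theorem refl_off : (refl : KSub B).off = .refl := rfl
@[simp] theorem refl_sub (j x : ℕ) : (refl : KSub B).sub j x = .var x := rfl
@[simp] theorem plug_off (n : ℕ) (τ : ℕ → Tm B) : (plug n τ).off = .plug n := rfl
@[simp] theorem plug_sub_zero (n : ℕ) (τ : ℕ → Tm B) : (plug n τ).sub 0 = τ := rfl
@[simp] theorem plug_sub_succ (n : ℕ) (τ : ℕ → Tm B) (j x : ℕ) :
    (plug n τ).sub (j + 1) x = .var x := rfl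

theorem funExt {κ κ' : KSub B} (h : ∀ j x, κ.sub j x = κ'.sub j x)
    (h' : ∀ j, κ.off j = κ'.off j) : κ = κ' :=
  KSub.ext (funext fun j => funext (h j)) (LevelMap.funExt h')

@[simp] theorem drop_zero (κ : KSub B) : κ.drop 0 = κ := funExt (by simp) (by simp)

@[simp] theorem refl_drop (n : ℕ) : (refl : KSub B).drop n = refl := funExt (by simp) (by simp)

@[simp] theorem refl_push : (refl : KSub B).push = refl :=
  funExt (fun j x => by cases j <;> rfl) (by simp)

@[simp] theorem refl_lam : (refl : KSub B).lam = refl :=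
  funExt (fun j x => by rcases j with _ | j <;> [cases x <;> rfl; simp [lam]]) (by simp)

@[simp] theorem plug_drop_succ (n : ℕ) (τ : ℕ → Tm B) (m : ℕ) :
    (plug n τ).drop (m + 1) = refl :=
  funExt (fun j x => by simp [show m + 1 + j = m + j + 1 by omega]) (by simp)

end KSub

/-- Application of a substitution for a whole stack. -/
def Tm.ksub : Tm B → KSub B → Tm B
  | .var x, κ => κ.sub 0 x
  | .lam T M, κ => .lam T (M.ksub κ.lam)
  | .app M N, κ => .app (M.ksub κ) (N.ksub κ)
  | .quo Δ M, κ => .quo Δ (M.ksub κ.push)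
  | .unq n M N, κ => .unq (κ.off n) (M.ksub (κ.drop n)) fun i => (N i).ksub κ

/-- Composition of substitutions, first `κ` and then `κ'`. -/
def KSub.comp (κ κ' : KSub B) : KSub B :=
  ⟨fun j x => (κ.sub j x).ksub (κ'.drop (κ.off j)), κ.off.comp κ'.off⟩

/-! ### Identity and composition laws for stack substitutions -/

theorem Tm.ksub_refl (M : Tm B) : M.ksub .refl = M := by
  induction M with
  | var x => rfl
  | lam T M ih => simp [ksub, ih]
  | app M N ih₁ ih₂ => simp [ksub, ih₁, ih₂]
  | quo Δ M ih => simp [ksub, ih]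
  | unq n M N ih₁ ih₂ => simp [ksub, ih₁, ih₂]

theorem Tm.ren_refl (M : Tm B) : (M.ren fun _ => id) = M := by
  have h₁ : Ren.lam (fun _ => id) = fun _ => id := by
    funext j x
    rcases j with _ | j
    · cases x <;> rfl
    · rfl
  have h₂ : Ren.push (fun _ => id) = fun _ => id := by
    funext j x
    cases j <;> rfl
  induction M with
  | var x => rfl
  | lam T M ih => rw [ren, h₁, ih]
  | app M N ih₁ ih₂ => rw [ren, ih₁, ih₂]
  | quo Δ M ih => rw [ren, h₂, ih]
  | unq n M N ih₁ ih₂ => simp only [ren, ih₁, ih₂]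

/-- Extension under `λ` weakens terms, so the two mixed laws for renamings have to precede the
composition law `Tm.ksub_ksub`. -/
theorem Tm.ren_ksub (M : Tm B) (ρ : Ren) (κ : KSub B) :
    (M.ren ρ).ksub κ = M.ksub ⟨fun j x => κ.sub j (ρ j x), κ.off⟩ := by
  induction M generalizing ρ κ with
  | var x => rfl
  | lam T M ih =>
    simp only [ren, ksub, ih]
    congr 2
    refine KSub.funExt (fun j x => ?_) fun _ => rfl
    rcases j with _ | j
    · cases x <;> rfl
    · rfl
  | app M N ih₁ ih₂ => simp only [ren, ksub, ih₁, ih₂]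
  | quo Δ M ih =>
    simp only [ren, ksub, ih]
    congr 2
    refine KSub.funExt (fun j x => ?_) fun _ => rfl
    cases j <;> rfl
  | unq n M N ih₁ ih₂ =>
    simp only [ren, ksub, ih₁, ih₂]
    rfl

theorem Tm.ksub_ren (M : Tm B) (κ : KSub B) (ρ : Ren) :
    (M.ksub κ).ren ρ = M.ksub ⟨fun j x => (κ.sub j x).ren fun i => ρ (κ.off j + i), κ.off⟩ := by
  induction M generalizing ρ κ with
  | var x => simp [ksub]
  | lam T M ih =>
    have key : ∀ N : Tm B, (N.ren .wk).ren ρ.lam = (N.ren ρ).ren .wk := fun N => by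
      rw [ren_ren, ren_ren]
      congr 1
      funext j x
      cases j <;> rfl
    simp only [ren, ksub, ih]
    congr 2
    refine KSub.funExt (fun j x => ?_) fun _ => rfl
    rcases j with _ | j
    · cases x with
      | zero => simp [KSub.lam, ren, Ren.lam, liftRen]
      | succ x => simpa [KSub.lam] using key _
    · by_cases h : κ.off (j + 1) = 0
      · simpa [KSub.lam, h] using key _
      · obtain ⟨m, hm⟩ := Nat.exists_eq_succ_of_ne_zero h
        simp only [KSub.lam, hm]
        simp only [Nat.succ_eq_add_one, Nat.add_eq_zero_iff, one_ne_zero, and_false, if_false]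
        congr 1
        funext i
        rw [show m + 1 + i = m + i + 1 by omega]
        rfl
  | app M N ih₁ ih₂ => simp only [ren, ksub, ih₁, ih₂]
  | quo Δ M ih =>
    simp only [ren, ksub, ih]
    congr 2
    refine KSub.funExt (fun j x => ?_) fun _ => rfl
    cases j with
    | zero => rfl
    | succ j =>
      simp only [KSub.push_off, LevelMap.push_succ, KSub.push_sub_succ]
      congr 1
      funext i
      rw [show κ.off j + 1 + i = κ.off j + i + 1 by omega]
      rfl
  | unq n M N ih₁ ih₂ =>
    simp only [ren, ksub, ih₁, ih₂]
    congr 2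
    refine KSub.funExt (fun j x => ?_) fun _ => rfl
    have := κ.off.le_add n j
    simp only [KSub.drop_sub, KSub.drop_off, LevelMap.drop_apply]
    congr 1
    funext i
    congr 1
    omega

/-- Weakening the innermost context commutes with substitution. -/
theorem Tm.wk_ksub_lam (M : Tm B) (κ : KSub B) :
    (M.ren .wk).ksub κ.lam = (M.ksub κ).ren .wk := by
  rw [ren_ksub, ksub_ren]
  congr 1
  refine KSub.funExt (fun j x => ?_) fun _ => rfl
  rcases j with _ | j
  · simp only [LevelMap.apply_zero, Nat.zero_add]
    rfl
  · by_cases h : κ.off (j + 1) = 0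
    · simp only [KSub.lam, h, if_true, Nat.zero_add]
      rfl
    · obtain ⟨m, hm⟩ := Nat.exists_eq_succ_of_ne_zero h
      -- Weakening changes only the innermost context, so it is the identity when read from any
      -- stack below it.
      have hwk : (fun i => Ren.wk (m + 1 + i)) = fun _ => id := by
        funext i
        rw [show m + 1 + i = m + i + 1 by omega]
        rfl
      simp only [KSub.lam, hm, Nat.succ_eq_add_one, hwk, ren_refl]
      rw [if_neg (by omega)]
      rfl

/-- When no target context is removed, the extended context is still visible after the drop, and all
of `lam` amounts to one weakening of the result. -/
theorem KSub.lam_drop_of_off_eq_zero (κ : KSub B) {n : ℕ} (hn : n ≠ 0) (h : κ.off n = 0)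
    (M : Tm B) : M.ksub (κ.lam.drop n) = (M.ksub (κ.drop n)).ren .wk := by
  obtain ⟨n, rfl⟩ := Nat.exists_eq_succ_of_ne_zero hn
  rw [Tm.ksub_ren]
  congr 1
  refine funExt (fun j x => ?_) fun _ => rfl
  simp only [Nat.succ_eq_add_one] at h ⊢
  simp only [drop_sub, drop_off, LevelMap.drop_apply, h, Nat.sub_zero,
    show n + 1 + j = n + j + 1 by omega, lam]
  by_cases h' : κ.off (n + j + 1) = 0
  · simp only [h', if_true, Nat.zero_add]
  · obtain ⟨m, hm⟩ := Nat.exists_eq_succ_of_ne_zero h'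
    have hwk : (fun i => Ren.wk (m + 1 + i)) = fun _ => id := by
      funext i
      rw [show m + 1 + i = m + i + 1 by omega]
      rfl
    rw [if_neg h']
    simp only [hm, Nat.succ_eq_add_one, hwk, Tm.ren_refl]

theorem KSub.lam_drop_of_off_ne_zero (κ : KSub B) {n : ℕ} (h : κ.off n ≠ 0) :
    κ.lam.drop n = κ.drop n := by
  refine funExt (fun j x => ?_) fun _ => rfl
  have := κ.off.le_add n j
  rcases n with _ | n
  · simp at h
  · rw [drop_sub, drop_sub]
    rw [show n + 1 + j = n + j + 1 by omega] at *
    simp only [KSub.lam]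
    rw [if_neg (by omega)]

theorem KSub.lam_comp (κ κ' : KSub B) : κ.lam.comp κ'.lam = (κ.comp κ').lam := by
  refine funExt (fun j x => ?_) fun _ => rfl
  rcases j with _ | j
  · cases x with
    | zero => simp [comp, lam, Tm.ksub]
    | succ x => simpa [comp, lam] using Tm.wk_ksub_lam _ _
  · by_cases h : κ.off (j + 1) = 0
    · simpa [comp, lam, h] using Tm.wk_ksub_lam _ _
    · have h₁ : (κ.lam.comp κ'.lam).sub (j + 1) x =
          (κ.sub (j + 1) x).ksub (κ'.lam.drop (κ.off (j + 1))) := by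
        simp only [comp, lam_sub_succ, lam_off, if_neg h]
      rw [h₁, lam_sub_succ]
      -- The first substitution leaves the term below its innermost context, but the second may
      -- merge that level into its own innermost one (as for `unq 0`); then the weakening comes from
      -- `κ'`.
      by_cases h' : κ'.off (κ.off (j + 1)) = 0
      · rw [if_pos (by exact h')]
        exact lam_drop_of_off_eq_zero κ' h h' _
      · rw [if_neg (by exact h'), lam_drop_of_off_ne_zero κ' h']
        rfl

theorem KSub.push_comp (κ κ' : KSub B) : κ.push.comp κ'.push = (κ.comp κ').push := by
  refine funExt (fun j x => ?_) fun j => by cases j <;> simp [comp]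
  cases j with
  | zero => simp [comp, Tm.ksub]
  | succ j =>
    simp only [comp, push_sub_succ, push_off, LevelMap.push_succ]
    congr 1
    refine funExt (fun i x => ?_) fun i => ?_
    · simp [show κ.off j + 1 + i = κ.off j + i + 1 by omega]
    · simp [show κ.off j + 1 + i = κ.off j + i + 1 by omega]

theorem KSub.drop_comp (κ κ' : KSub B) (n : ℕ) :
    (κ.drop n).comp (κ'.drop (κ.off n)) = (κ.comp κ').drop n := by
  refine KSub.ext (funext fun j => funext fun x => ?_) (LevelMap.drop_comp _ _ _)
  simp only [comp, drop_sub, drop_off, LevelMap.drop_apply]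
  congr 1
  have := κ.off.le_add n j
  refine funExt (fun i x => ?_) fun i => ?_
  · simp only [drop_sub]
    congr 1
    omega
  · have h₁ := κ'.off.mono this
    have h₂ := κ'.off.le_add (κ.off (n + j)) i
    simp only [drop_off, LevelMap.drop_apply]
    rw [show κ.off n + (κ.off (n + j) - κ.off n) = κ.off (n + j) by omega,
      show κ.off n + (κ.off (n + j) - κ.off n + i) = κ.off (n + j) + i by omega]
    omega

theorem Tm.ksub_ksub (M : Tm B) (κ κ' : KSub B) :
    (M.ksub κ).ksub κ' = M.ksub (κ.comp κ') := by
  induction M generalizing κ κ' with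
  | var x => simp [ksub, KSub.comp]
  | lam T M ih => rw [ksub, ksub, ksub, ih, KSub.lam_comp]
  | app M N ih₁ ih₂ => rw [ksub, ksub, ksub, ih₁, ih₂]
  | quo Δ M ih => rw [ksub, ksub, ksub, ih, KSub.push_comp]
  | unq n M N ih₁ ih₂ =>
    simp only [ksub, ih₁, ih₂, KSub.drop_comp]
    rfl

/-! ### Contraction of redexes and its commutation with substitution -/

/-- Instantiation of the new variable undoes weakening. -/
theorem Tm.wk_plug (M : Tm B) (N : Fin 1 → Tm B) :
    (M.ren .wk).ksub (.plug 1 (inst N)) = M := by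
  rw [ren_ksub]
  refine Eq.trans ?_ M.ksub_refl
  congr 1
  refine KSub.funExt (fun j x => ?_) fun j => ?_
  · cases j with
    | zero => simp [Ren.wk, inst]
    | succ j => rfl
  · simp [LevelMap.plug_one]

/-- The extension of `κ` to a new variable of the innermost context, which is mapped to `N`. -/
def KSub.cons (N : Tm B) (κ : KSub B) : KSub B where
  sub
    | 0, 0 => N
    | 0, x + 1 => κ.sub 0 x
    | j + 1, x => κ.sub (j + 1) x
  off := κ.off

theorem KSub.lam_comp_plug (κ : KSub B) (N : Tm B) :
    κ.lam.comp (.plug 1 (inst fun _ : Fin 1 => N)) = .cons N κ := by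
  refine funExt (fun j x => ?_) fun j => ?_
  · rcases j with _ | j
    · cases x with
      | zero => simp [comp, lam, cons, Tm.ksub, inst]
      | succ x => simpa [comp, lam, cons] using Tm.wk_plug _ _
    · by_cases h : κ.off (j + 1) = 0
      · simpa [comp, lam, cons, h] using Tm.wk_plug _ _
      · obtain ⟨m, hm⟩ := Nat.exists_eq_succ_of_ne_zero h
        simp [comp, lam, cons, hm, Tm.ksub_refl]
  · simp [comp, cons, LevelMap.plug_one]

/-- The weakenings made by `lam` are cancelled by the instantiation. Reducibility therefore never
has to be shown stable under renaming. -/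
theorem Tm.ksub_lam_plug (M N : Tm B) (κ : KSub B) :
    (M.ksub κ.lam).ksub (.plug 1 (inst fun _ : Fin 1 => N)) = M.ksub (.cons N κ) := by
  rw [ksub_ksub, KSub.lam_comp_plug]

theorem Tm.plug_ksub (M N : Tm B) (κ : KSub B) :
    (M.ksub (.plug 1 (inst fun _ : Fin 1 => N))).ksub κ =
      (M.ksub κ.lam).ksub (.plug 1 (inst fun _ : Fin 1 => N.ksub κ)) := by
  rw [ksub_lam_plug, ksub_ksub]
  congr 1
  refine KSub.funExt (fun j x => ?_) fun j => ?_
  · rcases j with _ | j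
    · cases x <;> simp [KSub.comp, KSub.cons, inst, ksub]
    · simp [KSub.comp, KSub.cons, ksub]
  · simp [KSub.comp, KSub.cons, LevelMap.plug_one]

/-- A closed term over every stack. -/
def closedTm : Tm B := .quo (k := 0) (fun i => i.elim0) (.var 0)

/-- The variant of `inst` that replaces the entries after the first `k` ones by a closed term.
It agrees with `inst` on the variables of a context of length `k`. -/
def instClosed {k : ℕ} (N : Fin k → Tm B) (x : ℕ) : Tm B :=
  if h : x < k then N ⟨x, h⟩ else closedTm

/-- The variable of `closedTm` refers to the context that its own quotation pushes, and `push` fixes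
it. The analogue for `inst` fails for entries beyond the first `k`. -/
theorem instClosed_ksub {k : ℕ} (N : Fin k → Tm B) (κ : KSub B) (x : ℕ) :
    (instClosed N x).ksub κ = instClosed (fun i => (N i).ksub κ) x := by
  unfold instClosed
  split <;> rfl

/-- The substitution `κ` with its innermost context replaced by terms `τ`, which live in a stack
with `n` further contexts. -/
def KSub.snoc (n : ℕ) (τ : ℕ → Tm B) (κ : KSub B) : KSub B where
  sub
    | 0, x => τ x
    | j + 1, x => κ.sub j x
  off := κ.off.push.comp (.plug n)

theorem Tm.ksub_push_plug (M : Tm B) (n : ℕ) (τ : ℕ → Tm B) (κ : KSub B) :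
    (M.ksub κ.push).ksub (.plug n τ) = M.ksub (.snoc n τ κ) := by
  rw [ksub_ksub]
  congr 1
  refine KSub.funExt (fun j x => ?_) fun j => rfl
  cases j <;> simp [KSub.comp, KSub.snoc, ksub, ksub_refl]

/-- The unquotation rule commutes with substitution: the body sees `κ` without `n` source contexts,
and the level becomes `κ.off n`. -/
theorem Tm.plug_ksub_instClosed {k : ℕ} (M : Tm B) (n : ℕ) (N : Fin k → Tm B) (κ : KSub B) :
    (M.ksub (.plug n (instClosed N))).ksub κ =
      (M.ksub (κ.drop n).push).ksub
        (.plug (κ.off n) (instClosed fun i => (N i).ksub κ)) := by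
  rw [ksub_push_plug, ksub_ksub]
  congr 1
  refine KSub.funExt (fun j x => ?_) fun j => ?_
  · cases j <;> simp [KSub.comp, KSub.snoc, ksub, instClosed_ksub, Nat.add_comm n]
  · cases j with
    | zero => simp [KSub.comp, KSub.snoc]
    | succ j =>
      have := κ.off.le_add n j
      simp only [KSub.comp, KSub.snoc, KSub.plug_off, LevelMap.comp_apply, LevelMap.plug_succ,
        KSub.drop_off, LevelMap.push_succ, LevelMap.drop_apply, Nat.add_comm j n]
      omega

/-! ### The operations of the calculus as substitutions of whole stacks -/

theorem Tm.rename_eq_ren (M : Tm B) {l : ℕ} (hl : 1 ≤ l) (ρ : ℕ → ℕ) :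
    M.rename l ρ = M.ren fun j => if j + 1 = l then ρ else id := by
  induction M generalizing l ρ with
  | var x =>
    by_cases h : l = 1
    · simp [rename, ren, h]
    · simp [rename, ren, h, Ne.symm h]
  | lam T M ih =>
    simp only [rename, ren, ih hl]
    congr 2
    funext j x
    rcases j with _ | j
    · by_cases h : l = 1
      · simp [h, Ren.lam]
      · cases x <;> simp [Ne.symm h, Ren.lam, liftRen]
    · by_cases h : l = 1
      · simp [h, Ren.lam]
      · simp [h, Ren.lam]
  | app M N ih₁ ih₂ => simp only [rename, ren, ih₁ hl, ih₂ hl]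
  | quo Δ M ih =>
    simp only [rename, ren, ih (Nat.le_add_left 1 l)]
    congr 2
    funext j
    cases j with
    | zero => simp [Ren.push, show l ≠ 0 by omega]
    | succ j => simp [Ren.push]
  | unq n M N ih₁ ih₂ =>
    simp only [rename, ren, ih₂ _ hl]
    congr 1
    by_cases h : l ≤ n
    · rw [if_pos h]
      refine (ren_refl M).symm.trans (congrArg M.ren (funext fun j => ?_))
      rw [if_neg (by omega)]
    · rw [if_neg h, ih₁ (by omega)]
      congr 1
      funext j
      have : j + 1 = l - n ↔ n + j + 1 = l := by omega
      simp [this]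

theorem Tm.rename_succ_eq_ren_wk (M : Tm B) : M.rename 1 Nat.succ = M.ren .wk := by
  rw [rename_eq_ren M le_rfl]
  congr 1
  funext j
  cases j <;> simp [Ren.wk]

/-- The substitution `σ` for the variables of level `l`. -/
def KSub.single (l : ℕ) (σ : ℕ → Tm B) : KSub B :=
  ⟨fun j x => if j + 1 = l then σ x else .var x, .refl⟩

theorem Tm.subst_eq_ksub (M : Tm B) {l : ℕ} (hl : 1 ≤ l) (σ : ℕ → Tm B) :
    M.subst l σ = M.ksub (.single l σ) := by
  induction M generalizing l σ with
  | var x =>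
    by_cases h : l = 1
    · simp [subst, ksub, KSub.single, h]
    · simp [subst, ksub, KSub.single, h, Ne.symm h]
  | lam T M ih =>
    simp only [subst, ksub, ih hl]
    congr 2
    refine KSub.funExt (fun j x => ?_) fun j => rfl
    rcases j with _ | j
    · by_cases h : l = 1
      · cases x <;> simp [h, KSub.lam, KSub.single, liftSub, rename_succ_eq_ren_wk]
      · cases x <;> simp [Ne.symm h, KSub.lam, KSub.single, ren, Ren.wk]
    · by_cases h : l = 1 <;> simp [h, KSub.lam, KSub.single]
  | app M N ih₁ ih₂ => simp only [subst, ksub, ih₁ hl, ih₂ hl]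
  | quo Δ M ih =>
    simp only [subst, ksub, ih (Nat.le_add_left 1 l)]
    congr 2
    refine KSub.funExt (fun j x => ?_) fun j => ?_
    · cases j with
      | zero => simp [KSub.single, show 0 ≠ l by omega]
      | succ j => simp [KSub.single]
    · simp [KSub.single]
  | unq n M N ih₁ ih₂ =>
    simp only [subst, ksub, ih₂ _ hl]
    congr 1
    by_cases h : l ≤ n
    · rw [if_pos h]
      refine (ksub_refl M).symm.trans (congrArg M.ksub (KSub.funExt (fun j x => ?_) fun j => ?_))
      · simp [KSub.single, show n + j + 1 ≠ l by omega]
      · simp [KSub.single]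
    · rw [if_neg h, ih₁ (by omega)]
      congr 1
      refine KSub.funExt (fun j x => ?_) fun j => ?_
      · have : j + 1 = l - n ↔ n + j + 1 = l := by omega
        simp [this, KSub.single]
      · simp [KSub.single]

/-- The substitution that performs the level substitution `↑ⁿₗ`. -/
def KSub.lev (n l d : ℕ) : KSub B where
  sub j x := if n = 0 ∧ j = l then .var (x + d) else .var x
  off :=
    -- The alternative `j = 0` matters only for the degenerate `l = 0`.
    { toFun := fun j => if j < l ∨ j = 0 then j else j + n - 1
      map_zero := by simp
      mono := fun i j hij => by
        dsimp only
        split_ifs <;> omega }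

theorem KSub.lev_off_of_lt (n d : ℕ) {l j : ℕ} (h : j < l) : (lev n l d : KSub B).off j = j :=
  if_pos (.inl h)

theorem KSub.lev_off_of_le (n d : ℕ) {l j : ℕ} (hl : 1 ≤ l) (h : l ≤ j) :
    (lev n l d : KSub B).off j = j + n - 1 := if_neg (by omega)

theorem Tm.lev_eq_ksub (M : Tm B) (n : ℕ) {l : ℕ} (hl : 1 ≤ l) (d : ℕ) :
    M.lev n l d = M.ksub (.lev n l d) := by
  induction M generalizing l d with
  | var x => simp [lev, ksub, KSub.lev, show 0 ≠ l by omega]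
  | lam T M ih =>
    simp only [lev, ksub, ih hl]
    congr 2
    refine KSub.funExt (fun j x => ?_) fun j => rfl
    rcases j with _ | j
    · cases x <;> simp [KSub.lam, KSub.lev, show 0 ≠ l by omega, ren, Ren.wk]
    · rw [KSub.lam_sub_succ]
      by_cases h : n = 0 ∧ j + 1 = l
      · obtain ⟨rfl, rfl⟩ := h
        rw [KSub.lev_off_of_le _ _ hl le_rfl]
        -- For `l = 1` the merged context is the innermost one, so crossing the `λ` weakens its
        -- variables once more; this is the passage from `d` to `d + 1`. For larger `l` nothing
        -- changes.
        rcases j with _ | j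
        · simp [KSub.lev, ren, Ren.wk, Nat.add_assoc]
        · simp [KSub.lev]
      · rw [show (KSub.lev n l d : KSub B).sub (j + 1) x = .var x from if_neg h,
          show (KSub.lev n l (if l = 1 then d + 1 else d) : KSub B).sub (j + 1) x = .var x from
            if_neg h, if_neg]
        rcases Nat.lt_or_ge (j + 1) l with h' | h'
        · rw [KSub.lev_off_of_lt _ _ h']
          omega
        · rw [KSub.lev_off_of_le _ _ hl h']
          omega
  | app M N ih₁ ih₂ => simp only [lev, ksub, ih₁ hl, ih₂ hl]
  | quo Δ M ih =>
    simp only [lev, ksub, ih (Nat.le_add_left 1 l)]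
    congr 2
    refine KSub.funExt (fun j x => ?_) fun j => ?_
    · cases j with
      | zero => simp [KSub.lev]
      | succ j => simp [KSub.lev]
    · cases j with
      | zero => simp
      | succ j =>
        simp only [KSub.push_off, LevelMap.push_succ]
        rcases Nat.lt_or_ge j l with h | h
        · rw [KSub.lev_off_of_lt _ _ h, KSub.lev_off_of_lt _ _ (by omega)]
        · rw [KSub.lev_off_of_le _ _ hl h, KSub.lev_off_of_le _ _ (by omega) (by omega)]
          omega
  | unq k M N ih₁ ih₂ =>
    simp only [lev, ksub, ih₂ _ hl]
    by_cases h : l ≤ k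
    · rw [if_pos h, KSub.lev_off_of_le _ _ hl h]
      congr 1
      have key : ∀ j, (KSub.drop (.lev n l d : KSub B) k).off j = j := fun j => by
        rw [KSub.drop_off, LevelMap.drop_apply, KSub.lev_off_of_le _ _ hl h,
          KSub.lev_off_of_le _ _ hl (by omega)]
        omega
      by_cases h' : n = 0 ∧ k = l
      · rw [if_pos h', rename_eq_ren M le_rfl, ← ksub_refl (M.ren _), ren_ksub]
        congr 1
        refine KSub.funExt (fun j x => ?_) fun j => (key j).symm
        obtain ⟨rfl, rfl⟩ := h'
        cases j <;> simp [KSub.lev]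
      · rw [if_neg h']
        refine (ksub_refl M).symm.trans
          (congrArg M.ksub (KSub.funExt (fun j x => ?_) fun j => (key j).symm))
        exact (if_neg (by omega)).symm
    · rw [if_neg h, KSub.lev_off_of_lt _ _ (by omega), ih₁ (by omega)]
      congr 1
      refine congrArg M.ksub (KSub.funExt (fun j x => ?_) fun j => ?_)
      · have : j = l - k ↔ k + j = l := by omega
        simp [this, KSub.lev]
      · rw [KSub.drop_off, LevelMap.drop_apply, KSub.lev_off_of_lt _ _ (show k < l by omega)]
        rcases Nat.lt_or_ge (k + j) l with h' | h'
        · rw [KSub.lev_off_of_lt _ _ h', KSub.lev_off_of_lt _ _ (by omega)]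
          omega
        · rw [KSub.lev_off_of_le _ _ hl h', KSub.lev_off_of_le _ _ (by omega) (by omega)]
          omega

theorem Tm.subst_one_eq_ksub_plug (M : Tm B) (τ : ℕ → Tm B) :
    M.subst 1 τ = M.ksub (.plug 1 τ) := by
  rw [subst_eq_ksub M le_rfl]
  congr 1
  refine KSub.funExt (fun j x => ?_) fun j => ?_
  · cases j <;> simp [KSub.single]
  · simp [KSub.single, LevelMap.plug_one]

theorem Tm.lev_subst_eq_ksub_plug {k : ℕ} (M : Tm B) (n : ℕ) (N : Fin k → Tm B) :
    (M.lev n 1 k).subst 1 (inst N) = M.ksub (.plug n (inst N)) := by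
  rw [subst_one_eq_ksub_plug, lev_eq_ksub M n le_rfl, ksub_ksub]
  congr 1
  refine KSub.funExt (fun j x => ?_) fun j => ?_
  · rcases j with _ | j
    · simp [KSub.comp, KSub.lev, ksub]
    -- For `n = 0` the variables of the merged context were shifted by `k`, and `inst N` takes
    -- exactly this shift back.
    · by_cases h : n = 0 ∧ j = 0
      · obtain ⟨rfl, rfl⟩ := h
        simp [KSub.comp, KSub.lev, ksub, inst]
      · simp only [KSub.comp, KSub.plug_sub_succ]
        have h' : (KSub.lev n 1 k : KSub B).sub (j + 1) x = .var x := if_neg (by omega)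
        obtain ⟨m, hm⟩ : ∃ m, j + n = m + 1 := ⟨j + n - 1, by omega⟩
        rw [h', KSub.lev_off_of_le _ _ le_rfl (by omega),
          show j + 1 + n - 1 = m + 1 by omega, KSub.plug_drop_succ]
        rfl
  · simp only [KSub.comp, KSub.plug_off, LevelMap.comp_apply, LevelMap.plug_one,
      LevelMap.refl_apply]
    cases j with
    | zero => simp
    | succ j =>
      rw [KSub.lev_off_of_le _ _ le_rfl (by omega), LevelMap.plug_succ]
      omega

/-! ### Scoping

Reduction does not preserve `Scoped` over the empty stack, because `unq 0` may expose an abstraction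
there. It does preserve the following variant for infinite stacks. -/

/-- The lengths of the contexts of a stack after a new entry in the innermost context. -/
def bumpScope (g : ℕ → ℕ) : ℕ → ℕ
  | 0 => g 0 + 1
  | j + 1 => g (j + 1)

/-- The lengths of the contexts of a stack with a new innermost context of length `k`. -/
def pushScope (k : ℕ) (g : ℕ → ℕ) : ℕ → ℕ
  | 0 => k
  | j + 1 => g j

/-- Every variable of the term is an entry of the context that it refers to, in an infinite stack
with contexts of the lengths `g`. -/
def Tm.InScope : Tm B → (ℕ → ℕ) → Prop
  | .var x, g => x < g 0
  | .lam _ M, g => M.InScope (bumpScope g)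
  | .app M N, g => M.InScope g ∧ N.InScope g
  | .quo (k := k) _ M, g => M.InScope (pushScope k g)
  | .unq n M N, g => (M.InScope fun j => g (n + j)) ∧ ∀ i, (N i).InScope g

/-- The finite stack is padded with empty contexts, which contain no variables. -/
theorem Scoped.inScope {s : List ℕ} {M : Tm B} (h : Scoped s M) :
    M.InScope fun j => s.getD j 0 := by
  induction h with
  | var h => exact h
  | @lam _ _ _ M _ ih =>
    refine (congrArg M.InScope (funext fun j => ?_)).mp ih
    cases j <;> rfl
  | app _ _ ih₁ ih₂ => exact ⟨ih₁, ih₂⟩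
  | @quo _ _ _ M _ ih =>
    refine (congrArg M.InScope (funext fun j => ?_)).mp ih
    cases j <;> rfl
  | unq _ _ _ ih₁ ih₂ =>
    refine ⟨(congrArg (Tm.InScope _) (funext fun j => ?_)).mp ih₁, ih₂⟩
    simp [List.getD_eq_getElem?_getD]

namespace Tm.InScope

theorem ren {g g' : ℕ → ℕ} {M : Tm B} {ρ : Ren} (h : M.InScope g)
    (hρ : ∀ j, ∀ x < g j, ρ j x < g' j) : (M.ren ρ).InScope g' := by
  induction M generalizing g g' ρ with
  | var x => exact hρ 0 x h
  | lam T M ih =>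
    refine ih h fun j x hx => ?_
    rcases j with _ | j
    · cases x with
      | zero => exact Nat.succ_pos _
      | succ x => exact Nat.succ_lt_succ (hρ 0 x (Nat.lt_of_succ_lt_succ hx))
    · exact hρ (j + 1) x hx
  | app M N ih₁ ih₂ => exact ⟨ih₁ h.1 hρ, ih₂ h.2 hρ⟩
  | quo Δ M ih =>
    refine ih h fun j x hx => ?_
    cases j with
    | zero => exact hx
    | succ j => exact hρ j x hx
  | unq n M N ih₁ ih₂ => exact ⟨ih₁ h.1 fun j => hρ (n + j), fun i => ih₂ i (h.2 i) hρ⟩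

theorem wk {g : ℕ → ℕ} {M : Tm B} (h : M.InScope g) : (M.ren .wk).InScope (bumpScope g) := by
  refine h.ren fun j x hx => ?_
  cases j with
  | zero => exact Nat.succ_lt_succ hx
  | succ j => exact hx

theorem ksub {g g' : ℕ → ℕ} {M : Tm B} {κ : KSub B} (h : M.InScope g)
    (hκ : ∀ j, ∀ x < g j, (κ.sub j x).InScope fun i => g' (κ.off j + i)) :
    (M.ksub κ).InScope g' := by
  induction M generalizing g g' κ with
  | var x => simpa [Tm.ksub] using hκ 0 x h
  | lam T M ih =>
    refine ih h fun j x hx => ?_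
    rcases j with _ | j
    · cases x with
      | zero => simp [KSub.lam, Tm.InScope, bumpScope]
      | succ x =>
        have h₁ := hκ 0 x (Nat.lt_of_succ_lt_succ hx)
        simp only [LevelMap.apply_zero, Nat.zero_add] at h₁
        simpa [KSub.lam] using h₁.wk
    · have h₁ := hκ (j + 1) x hx
      rw [KSub.lam_sub_succ, KSub.lam_off]
      by_cases h₂ : κ.off (j + 1) = 0
      · rw [if_pos h₂]
        simp only [h₂, Nat.zero_add] at h₁ ⊢
        exact h₁.wk
      · obtain ⟨m, hm⟩ := Nat.exists_eq_succ_of_ne_zero h₂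
        rw [if_neg h₂]
        refine (congrArg (Tm.InScope _) (funext fun i => ?_)).mp h₁
        rw [hm, show m.succ + i = m + i + 1 by omega]
        rfl
  | app M N ih₁ ih₂ => exact ⟨ih₁ h.1 hκ, ih₂ h.2 hκ⟩
  | quo Δ M ih =>
    refine ih h fun j x hx => ?_
    cases j with
    | zero => exact hx
    | succ j =>
      refine (congrArg (Tm.InScope _) (funext fun i => ?_)).mp (hκ j x hx)
      rw [KSub.push_off, LevelMap.push_succ, show κ.off j + 1 + i = κ.off j + i + 1 by omega]
      rfl
  | unq n M N ih₁ ih₂ =>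
    refine ⟨ih₁ h.1 fun j x hx => ?_, fun i => ih₂ i (h.2 i) hκ⟩
    refine (congrArg (Tm.InScope _) (funext fun i => ?_)).mp (hκ (n + j) x hx)
    have := κ.off.le_add n j
    rw [KSub.drop_off, LevelMap.drop_apply]
    congr 1
    omega

/-- The action of a substitution depends only on the terms for the variables in scope. -/
theorem ksub_congr {g : ℕ → ℕ} {M : Tm B} {κ κ' : KSub B} (h : M.InScope g)
    (hκ : ∀ j, ∀ x < g j, κ.sub j x = κ'.sub j x) (ho : κ.off = κ'.off) :
    M.ksub κ = M.ksub κ' := by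
  induction M generalizing g κ κ' with
  | var x => exact hκ 0 x h
  | lam T M ih =>
    rw [Tm.ksub, Tm.ksub]
    congr 1
    refine ih h (fun j x hx => ?_) ho
    rcases j with _ | j
    · cases x with
      | zero => rfl
      | succ x => exact congrArg (Tm.ren · .wk) (hκ 0 x (Nat.lt_of_succ_lt_succ hx))
    · rw [KSub.lam_sub_succ, KSub.lam_sub_succ, hκ (j + 1) x hx, ho]
  | app M N ih₁ ih₂ => rw [Tm.ksub, Tm.ksub, ih₁ h.1 hκ ho, ih₂ h.2 hκ ho]
  | quo Δ M ih =>
    rw [Tm.ksub, Tm.ksub]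
    congr 1
    refine ih h (fun j x hx => ?_) (by simp [ho])
    cases j with
    | zero => rfl
    | succ j => exact hκ j x hx
  | unq n M N ih₁ ih₂ =>
    simp only [Tm.ksub, ho, ih₂ _ (h.2 _) hκ ho]
    congr 1
    exact ih₁ h.1 (fun j x hx => hκ (n + j) x hx) (by simp [ho])

theorem ksub_plug_inst {k n : ℕ} {g : ℕ → ℕ} {M : Tm B} (h : M.InScope (pushScope k g))
    (N : Fin k → Tm B) : M.ksub (.plug n (inst N)) = M.ksub (.plug n (instClosed N)) := by
  refine h.ksub_congr (fun j x hx => ?_) rfl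
  cases j with
  | zero => simp [inst, instClosed, show x < k from hx]
  | succ j => rfl

theorem beta {g : ℕ → ℕ} {M N : Tm B} (hM : M.InScope (bumpScope g)) (hN : N.InScope g) :
    (M.ksub (.plug 1 (inst fun _ : Fin 1 => N))).InScope g := by
  refine hM.ksub fun j x hx => ?_
  rcases j with _ | j
  · cases x with
    | zero => simpa [inst] using hN
    | succ x => simpa [inst, Tm.InScope] using Nat.lt_of_succ_lt_succ hx
  · have hx' : x < g (j + 1) := hx
    simpa [Tm.InScope, LevelMap.plug_one] using hx'

theorem unquote {k n : ℕ} {g : ℕ → ℕ} {M : Tm B} {N : Fin k → Tm B}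
    (hM : M.InScope (pushScope k fun j => g (n + j))) (hN : ∀ i, (N i).InScope g) :
    (M.ksub (.plug n (instClosed N))).InScope g := by
  refine hM.ksub fun j x hx => ?_
  cases j with
  | zero => simpa [instClosed, show x < k from hx] using hN _
  | succ j =>
    have hx' : x < g (n + j) := hx
    simpa [Tm.InScope, Nat.add_comm j n] using hx'

end Tm.InScope

/-! ### Strong normalization -/

/-- The reduction that agrees with `Step` on well-scoped terms, with `instClosed` instead of `inst`
in the second rule. It is closed under substitution. -/
inductive KStep : Tm B → Tm B → Prop
  | beta (T : Ty B) (M N : Tm B) :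
      KStep (.app (.lam T M) N) (M.ksub (.plug 1 (inst fun _ : Fin 1 => N)))
  | unquote {k : ℕ} (n : ℕ) (Δ : Fin k → Ty B) (M : Tm B) (N : Fin k → Tm B) :
      KStep (.unq n (.quo Δ M) N) (M.ksub (.plug n (instClosed N)))
  | lam (T : Ty B) {M M' : Tm B} : KStep M M' → KStep (.lam T M) (.lam T M')
  | appL {M M' : Tm B} (N : Tm B) : KStep M M' → KStep (.app M N) (.app M' N)
  | appR (M : Tm B) {N N' : Tm B} : KStep N N' → KStep (.app M N) (.app M N')
  | quo {k : ℕ} (Δ : Fin k → Ty B) {M M' : Tm B} : KStep M M' → KStep (.quo Δ M) (.quo Δ M')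
  | unqL {k : ℕ} (n : ℕ) {M M' : Tm B} (N : Fin k → Tm B) :
      KStep M M' → KStep (.unq n M N) (.unq n M' N)
  | unqR {k : ℕ} (n : ℕ) (M : Tm B) (N : Fin k → Tm B) (i : Fin k) {L : Tm B} :
      KStep (N i) L → KStep (.unq n M N) (.unq n M (Function.update N i L))

/-- Together with `SN.of_map` this yields `SN M` from the normalization of a single instance of `M`,
as needed for bodies of abstractions and quotations. -/
theorem KStep.ksub {M M' : Tm B} (h : KStep M M') (κ : KSub B) :
    KStep (M.ksub κ) (M'.ksub κ) := by
  induction h generalizing κ with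
  | beta T M N =>
    rw [Tm.plug_ksub]
    exact .beta T _ _
  | unquote n Δ M N =>
    rw [Tm.plug_ksub_instClosed]
    exact .unquote _ Δ _ _
  | lam T _ ih => exact .lam T (ih _)
  | appL N _ ih => exact .appL _ (ih κ)
  | appR M _ ih => exact .appR _ (ih κ)
  | quo Δ _ ih => exact .quo Δ (ih _)
  | unqL n N _ ih => exact .unqL _ _ (ih _)
  | unqR n M N i _ ih =>
    have := KStep.unqR (κ.off n) (M.ksub (κ.drop n)) (fun i => (N i).ksub κ) i (ih κ)
    simp only [Tm.ksub]
    convert this using 2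
    funext j
    by_cases hj : j = i
    · subst hj
      simp
    · simp [hj]

theorem Step.kStep {g : ℕ → ℕ} {M M' : Tm B} (h : Step M M') (hM : M.InScope g) :
    KStep M M' := by
  induction h generalizing g with
  | beta T M N =>
    rw [Tm.subst_one_eq_ksub_plug]
    exact .beta T M N
  | unquote n Δ M N =>
    rw [Tm.lev_subst_eq_ksub_plug, Tm.InScope.ksub_plug_inst hM.1]
    exact .unquote n Δ M N
  | lam T _ ih => exact .lam T (ih hM)
  | appL N _ ih => exact .appL N (ih hM.1)
  | appR M _ ih => exact .appR M (ih hM.2)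
  | quo Δ _ ih => exact .quo Δ (ih hM)
  | unqL n N _ ih => exact .unqL n N (ih hM.1)
  | unqR n M N i _ ih => exact .unqR n M N i (ih (hM.2 i))

theorem KStep.inScope {g : ℕ → ℕ} {M M' : Tm B} (h : KStep M M') (hM : M.InScope g) :
    M'.InScope g := by
  induction h generalizing g with
  | beta T M N => exact Tm.InScope.beta hM.1 hM.2
  | unquote n Δ M N => exact Tm.InScope.unquote hM.1 hM.2
  | lam T _ ih => exact ih hM
  | appL N _ ih => exact ⟨ih hM.1, hM.2⟩
  | appR M _ ih => exact ⟨hM.1, ih hM.2⟩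
  | quo Δ _ ih => exact ih hM
  | unqL n N _ ih => exact ⟨ih hM.1, hM.2⟩
  | unqR n M N i _ ih =>
    refine ⟨hM.1, fun j => ?_⟩
    by_cases hj : j = i
    · subst hj
      simpa using ih (hM.2 j)
    · simpa [hj] using hM.2 j

/-! ### Accessibility and reducibility -/

/-- Strong normalization, as accessibility. -/
def SN (M : Tm B) : Prop := Acc (fun M' M => KStep M M') M

theorem SN.step {M M' : Tm B} (h : SN M) (hM : KStep M M') : SN M' := h.inv hM

theorem SN.of_map {f : Tm B → Tm B} (hf : ∀ {M M'}, KStep M M' → KStep (f M) (f M')) {M : Tm B}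
    (h : SN (f M)) : SN M := by
  generalize hN : f M = N at h
  induction h generalizing M with
  | intro N _ ih =>
    subst hN
    exact ⟨_, fun M' hM' => ih _ (hf hM') rfl⟩

/-- Tuples of accessible elements are accessible for reductions of one entry. -/
theorem acc_update {ι α : Type*} [DecidableEq ι] {r : α → α → Prop} (s : Finset ι) (f : ι → α)
    (hf : ∀ i ∈ s, Acc r (f i)) :
    Acc (fun f' f : ι → α => ∃ i ∈ s, ∃ a, r a (f i) ∧ f' = Function.update f i a) f := by
  induction s using Finset.induction_on generalizing f with
  | empty => exact ⟨_, fun f' ⟨i, hi, _⟩ => absurd hi (Finset.notMem_empty i)⟩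
  | insert a s ha ih =>
    have hfa := hf a (Finset.mem_insert_self a s)
    replace hf : ∀ i ∈ s, Acc r (f i) := fun i hi => hf i (Finset.mem_insert_of_mem hi)
    generalize hx : f a = x at hfa
    induction hfa generalizing f with
    | intro x hx' ihx =>
      have := ih f hf
      -- Lexicographic argument: the outer induction handles a step of entry `a`, the inner one a
      -- step of an entry in `s`, which leaves entry `a` unchanged.
      induction this with
      | intro f hf' ihf =>
        refine ⟨_, ?_⟩
        rintro _ ⟨i, hi, b, hb, rfl⟩
        rcases Finset.mem_insert.1 hi with rfl | hi
        · refine ihx b (hx ▸ hb) _ (fun j hj => ?_) (by simp)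
          rw [Function.update_of_ne (by rintro rfl; exact ha hj)]
          exact hf j hj
        · have hne : a ≠ i := by
            rintro rfl
            exact ha hi
          refine ihf _ ⟨i, hi, b, hb, rfl⟩ (fun j hj => ?_) ?_
          · by_cases hji : j = i
            · subst hji
              simpa using (hf j hj).inv hb
            · simpa [hji] using hf j hj
          · rw [Function.update_of_ne hne, hx]

theorem SN.tuple {k : ℕ} {N : Fin k → Tm B} (h : ∀ i, SN (N i)) :
    Acc (fun N' N : Fin k → Tm B => ∃ i L, KStep (N i) L ∧ N' = Function.update N i L) N :=
  Subrelation.accessible (fun ⟨i, L, h⟩ => ⟨i, Finset.mem_univ i, L, h⟩)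
    (acc_update Finset.univ N fun i _ => h i)

/-- Terms that are neither abstractions nor quotations. -/
def Tm.Neutral : Tm B → Prop
  | .lam _ _ => False
  | .quo _ _ => False
  | _ => True

/-- The reducibility predicates. -/
def Ty.Red : Ty B → Tm B → Prop
  | .base _, M => SN M
  | .arrow S T, M => ∀ N, S.Red N → T.Red (.app M N)
  | .box S T, M => ∀ n N, (∀ i, (S i).Red (N i)) → T.Red (.unq n M N)

theorem Ty.Red.step {T : Ty B} {M M' : Tm B} (h : T.Red M) (hM : KStep M M') : T.Red M' := by
  induction T generalizing M M' with
  | base b => exact SN.step h hM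
  | arrow S T _ ih => exact fun N hN => ih (h N hN) (.appL N hM)
  | box S T _ ih => exact fun n N hN => ih (h n N hN) (.unqL n N hM)

/-- Both properties need a joint induction: normalization tests a term on variables, which are
reducible by the neutral-term property of the argument types, and the neutral-term property needs
arguments to normalize. -/
theorem Ty.red_aux (T : Ty B) : (∀ M, T.Red M → SN M) ∧
    ∀ M : Tm B, M.Neutral → (∀ M', KStep M M' → T.Red M') → T.Red M := by
  induction T with
  | base b => exact ⟨fun M h => h, fun M _ h => ⟨_, h⟩⟩
  | arrow S T ihS ihT =>
    refine ⟨fun M h => ?_, fun M hM h N hN => ?_⟩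
    · have hv : S.Red (.var 0) := ihS.2 _ trivial fun M' h => nomatch h
      exact (ihT.1 _ (h _ hv)).of_map fun h => .appL _ h
    · have hsn := ihS.1 N hN
      induction hsn with
      | intro N _ ih =>
        refine ihT.2 _ trivial fun M' hM' => ?_
        cases hM' with
        | beta => exact hM.elim
        | appL _ h' => exact h _ h' N hN
        | appR _ h' => exact ih _ h' (hN.step h')
  | box S T ihS ihT =>
    refine ⟨fun M h => ?_, fun M hM h n N hN => ?_⟩
    · have hv : ∀ i, (S i).Red (.var 0) := fun i => (ihS i).2 _ trivial fun M' h => nomatch h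
      exact (ihT.1 _ (h 0 (fun _ => .var 0) hv)).of_map fun h => .unqL _ _ h
    · have hsn := SN.tuple fun i => (ihS i).1 _ (hN i)
      induction hsn with
      | intro N _ ih =>
        refine ihT.2 _ trivial fun M' hM' => ?_
        cases hM' with
        | unquote => exact hM.elim
        | unqL _ _ h' => exact h _ h' n N hN
        | unqR _ _ _ i h' =>
          refine ih _ ⟨i, _, h', rfl⟩ fun j => ?_
          by_cases hj : j = i
          · subst hj
            simpa using (hN j).step h'
          · simpa [hj] using hN j

theorem Ty.Red.sn {T : Ty B} {M : Tm B} (h : T.Red M) : SN M := T.red_aux.1 M h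

theorem Ty.red_of_neutral (T : Ty B) {M : Tm B} (hM : M.Neutral)
    (h : ∀ M', KStep M M' → T.Red M') : T.Red M := T.red_aux.2 M hM h

theorem Ty.red_var (T : Ty B) (x : ℕ) : T.Red (.var x) :=
  T.red_of_neutral trivial fun _ h => nomatch h

theorem Ty.red_lam {S T : Ty B} {M : Tm B} (U : Ty B)
    (h : ∀ N, S.Red N → T.Red (M.ksub (.plug 1 (inst fun _ : Fin 1 => N)))) :
    (Ty.arrow S T).Red (.lam U M) := by
  intro N hN
  have hM : SN M := (h _ (S.red_var 0)).sn.of_map fun h => h.ksub _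
  induction hM generalizing N with
  | intro M _ ihM =>
    have hsn := hN.sn
    induction hsn with
    | intro N _ ihN =>
      refine T.red_of_neutral trivial fun M' hM' => ?_
      cases hM' with
      | beta => exact h N hN
      | appL _ h' =>
        cases h' with
        | lam _ h' => exact ihM _ h' (fun N hN => (h N hN).step (h'.ksub _)) N hN
      | appR _ h' => exact ihN _ h' (hN.step h')

/-- The unquotation is neutral, so its one-step reducts suffice. Nested inductions on the
normalization of the body and of the tuple handle inner steps; the contractum is the hypothesis. -/
theorem Ty.red_quo {k : ℕ} {S : Fin k → Ty B} {T : Ty B} {M : Tm B} (Δ : Fin k → Ty B)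
    (h : ∀ n N, (∀ i, (S i).Red (N i)) → T.Red (M.ksub (.plug n (instClosed N)))) :
    (Ty.box S T).Red (.quo Δ M) := by
  intro n N hN
  have hM : SN M :=
    (h 0 (fun _ => .var 0) fun i => (S i).red_var 0).sn.of_map fun h => h.ksub _
  induction hM generalizing N with
  | intro M _ ihM =>
    have hsn := SN.tuple fun i => (hN i).sn
    induction hsn with
    | intro N _ ihN =>
      refine T.red_of_neutral trivial fun M' hM' => ?_
      cases hM' with
      | unquote => exact h n N hN
      | unqL _ _ h' =>
        cases h' with
        | quo _ h' => exact ihM _ h' (fun n N hN => (h n N hN).step (h'.ksub _)) N hN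
      | unqR _ _ _ i h' =>
        refine ihN _ ⟨i, _, h', rfl⟩ fun j => ?_
        by_cases hj : j = i
        · subst hj
          simpa using (hN j).step h'
        · simpa [hj] using hN j

/-! ### The fundamental lemma and its consequences -/

theorem HasType.red {A : Variant} {Ψ : Stack B} {M : Tm B} {T : Ty B} (h : HasType A Ψ M T)
    (κ : KSub B)
    (hκ : ∀ (j : ℕ) (Γ : Ctx B) (x : ℕ) (S : Ty B),
      Ψ[j]? = some Γ → Γ[x]? = some S → S.Red (κ.sub j x)) :
    T.Red (M.ksub κ) := by
  induction h generalizing κ with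
  | var h => exact hκ 0 _ _ _ rfl h
  | @lam Ψ Γ M S T _ ih =>
    refine Ty.red_lam T fun N hN => ?_
    rw [Tm.ksub_lam_plug]
    refine ih _ fun j Γ' x S' hj hx => ?_
    rcases j with _ | j
    · cases hj
      cases x with
      | zero =>
        cases hx
        exact hN
      | succ x => exact hκ 0 _ x _ rfl hx
    · exact hκ (j + 1) _ _ _ hj hx
  | app _ _ ih₁ ih₂ => exact ih₁ κ hκ _ (ih₂ κ hκ)
  | @quo Ψ k Δ M T _ ih =>
    refine Ty.red_quo Δ fun n N hN => ?_
    rw [Tm.ksub_push_plug]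
    refine ih _ fun j Γ' x S' hj hx => ?_
    cases j with
    | zero =>
      cases hj
      obtain ⟨hx', rfl⟩ := List.getElem?_eq_some_iff.1 hx
      have hx'' : x < k := by simpa using hx'
      simpa [KSub.snoc, instClosed, hx''] using hN ⟨x, hx''⟩
    | succ j => exact hκ j _ _ _ hj hx
  | @unq Φ n k M N T S _ _ _ _ ih₁ ih₂ =>
    -- The box candidate is used at level `κ.off n`, which `A` need not allow.
    refine ih₁ (κ.drop n) (fun j Γ' x S' hj hx => ?_) _ _ fun i => ih₂ i κ hκ
    rw [List.getElem?_drop] at hj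
    exact hκ _ _ _ _ hj hx

theorem HasType.sn {A : Variant} {Ψ : Stack B} {M : Tm B} {T : Ty B} (h : HasType A Ψ M T) :
    SN M := by
  have := h.red .refl fun j Γ x S _ _ => S.red_var x
  rw [Tm.ksub_refl] at this
  exact this.sn

theorem SN.stronglyNormalizing {g : ℕ → ℕ} {M : Tm B} (h : SN M) (hM : M.InScope g) :
    StronglyNormalizing M := by
  induction h with
  | intro M _ ih =>
    rintro ⟨f, rfl, hf⟩
    have h₁ := (hf 0).kStep hM
    exact ih _ h₁ (h₁.inScope hM) ⟨fun i => f (i + 1), rfl, fun i => hf (i + 1)⟩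

/-! ### Confluence -/

/-- Parallel reduction. -/
inductive Par : Tm B → Tm B → Prop
  | var (x : ℕ) : Par (.var x) (.var x)
  | lam (T : Ty B) {M M' : Tm B} : Par M M' → Par (.lam T M) (.lam T M')
  | app {M M' N N' : Tm B} : Par M M' → Par N N' → Par (.app M N) (.app M' N')
  | quo {k : ℕ} (Δ : Fin k → Ty B) {M M' : Tm B} : Par M M' → Par (.quo Δ M) (.quo Δ M')
  | unq {k : ℕ} (n : ℕ) {M M' : Tm B} {N N' : Fin k → Tm B} :
      Par M M' → (∀ i, Par (N i) (N' i)) → Par (.unq n M N) (.unq n M' N')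
  | beta (T : Ty B) {M M' N N' : Tm B} : Par M M' → Par N N' →
      Par (.app (.lam T M) N) (M'.ksub (.plug 1 (inst fun _ : Fin 1 => N')))
  | unquote {k : ℕ} (n : ℕ) (Δ : Fin k → Ty B) {M M' : Tm B} {N N' : Fin k → Tm B} :
      Par M M' → (∀ i, Par (N i) (N' i)) →
      Par (.unq n (.quo Δ M) N) (M'.ksub (.plug n (instClosed N')))

/-- The renaming `ρ` as a substitution. -/
def KSub.ofRen (ρ : Ren) : KSub B := ⟨fun j x => .var (ρ j x), .refl⟩

theorem Tm.ren_eq_ksub (M : Tm B) (ρ : Ren) : M.ren ρ = M.ksub (.ofRen ρ) := by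
  rw [← ksub_refl (M.ren ρ), ren_ksub]
  rfl

theorem KSub.ofRen_lam (ρ : Ren) : (ofRen ρ : KSub B).lam = ofRen ρ.lam := by
  refine funExt (fun j x => ?_) fun _ => rfl
  rcases j with _ | j
  · cases x <;> rfl
  · simp [lam, ofRen, Ren.lam]

theorem KSub.ofRen_push (ρ : Ren) : (ofRen ρ : KSub B).push = ofRen ρ.push :=
  funExt (fun j x => by cases j <;> rfl) fun j => by simp [ofRen]

theorem KSub.ofRen_drop (ρ : Ren) (n : ℕ) :
    (ofRen ρ : KSub B).drop n = ofRen fun j => ρ (n + j) :=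
  funExt (fun _ _ => rfl) fun j => by simp [ofRen]

namespace Par

theorem refl (M : Tm B) : Par M M := by
  induction M with
  | var x => exact .var x
  | lam T M ih => exact .lam T ih
  | app M N ih₁ ih₂ => exact .app ih₁ ih₂
  | quo Δ M ih => exact .quo Δ ih
  | unq n M N ih₁ ih₂ => exact .unq n ih₁ ih₂

/-- Needed for the weakenings that `KSub.lam` introduces in `Par.ksub`. -/
theorem ren {M M' : Tm B} (h : Par M M') (ρ : Ren) : Par (M.ren ρ) (M'.ren ρ) := by
  induction h generalizing ρ with
  | var x => exact .var _
  | lam T _ ih => exact .lam T (ih _)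
  | app _ _ ih₁ ih₂ => exact .app (ih₁ ρ) (ih₂ ρ)
  | quo Δ _ ih => exact .quo Δ (ih _)
  | unq n _ _ ih₁ ih₂ => exact .unq n (ih₁ _) fun i => ih₂ i ρ
  | @beta T M M' N N' _ _ ih₁ ih₂ =>
    have := Par.beta T (ih₁ ρ.lam) (ih₂ ρ)
    rwa [Tm.ren_eq_ksub M', Tm.ren_eq_ksub N', ← KSub.ofRen_lam, ← Tm.plug_ksub,
      ← Tm.ren_eq_ksub] at this
  | @unquote k n Δ M M' N N' _ _ ih₁ ih₂ =>
    have := Par.unquote n Δ (ih₁ (Ren.push fun j => ρ (n + j))) fun i => ih₂ i ρ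
    have h := Tm.plug_ksub_instClosed M' n N' (.ofRen ρ)
    simp only [KSub.ofRen_drop, KSub.ofRen_push, ← Tm.ren_eq_ksub] at h
    rw [h]
    exact this

theorem ksub {M M' : Tm B} (h : Par M M') {κ κ' : KSub B} (ho : κ.off = κ'.off)
    (hκ : ∀ j x, Par (κ.sub j x) (κ'.sub j x)) : Par (M.ksub κ) (M'.ksub κ') := by
  have hlam : ∀ {κ κ' : KSub B}, κ.off = κ'.off → (∀ j x, Par (κ.sub j x) (κ'.sub j x)) →
      ∀ j x, Par (κ.lam.sub j x) (κ'.lam.sub j x) := fun {κ κ'} ho hκ j x => by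
    rcases j with _ | j
    · cases x with
      | zero => exact .var 0
      | succ x => exact (hκ 0 x).ren _
    · rw [KSub.lam_sub_succ, KSub.lam_sub_succ, ho]
      split
      · exact (hκ _ x).ren _
      · exact hκ _ x
  have hpush : ∀ {κ κ' : KSub B}, (∀ j x, Par (κ.sub j x) (κ'.sub j x)) →
      ∀ j x, Par (κ.push.sub j x) (κ'.push.sub j x) := fun {κ κ'} hκ j x => by
    cases j with
    | zero => exact .var x
    | succ j => exact hκ j x
  induction h generalizing κ κ' with
  | var x => exact hκ 0 x
  | lam T _ ih => exact .lam T (ih ho (hlam ho hκ))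
  | app _ _ ih₁ ih₂ => exact .app (ih₁ ho hκ) (ih₂ ho hκ)
  | quo Δ _ ih => exact .quo Δ (ih (by simp [ho]) (hpush hκ))
  | unq n _ _ ih₁ ih₂ =>
    rw [Tm.ksub, Tm.ksub, ho]
    exact .unq _ (ih₁ (by simp [ho]) fun j x => hκ _ x) fun i => ih₂ i ho hκ
  | beta T _ _ ih₁ ih₂ =>
    rw [Tm.plug_ksub]
    exact .beta T (ih₁ ho (hlam ho hκ)) (ih₂ ho hκ)
  | unquote n Δ _ _ ih₁ ih₂ =>
    rw [Tm.plug_ksub_instClosed, Tm.ksub, Tm.ksub, ho]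
    exact .unquote _ Δ (ih₁ (by simp [ho]) (hpush fun j x => hκ _ x)) fun i => ih₂ i ho hκ

theorem plug_inst {M M' N N' : Tm B} (hM : Par M M') (hN : Par N N') :
    Par (M.ksub (.plug 1 (inst fun _ : Fin 1 => N)))
      (M'.ksub (.plug 1 (inst fun _ : Fin 1 => N'))) := by
  refine hM.ksub rfl fun j x => ?_
  cases j with
  | zero =>
    simp only [KSub.plug_sub_zero, inst]
    split
    · exact hN
    · exact .var _
  | succ j => exact .var x

theorem plug_instClosed {k n : ℕ} {M M' : Tm B} {N N' : Fin k → Tm B} (hM : Par M M')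
    (hN : ∀ i, Par (N i) (N' i)) :
    Par (M.ksub (.plug n (instClosed N))) (M'.ksub (.plug n (instClosed N'))) := by
  refine hM.ksub rfl fun j x => ?_
  cases j with
  | zero =>
    simp only [KSub.plug_sub_zero, instClosed]
    split
    · exact hN _
    · exact .refl _
  | succ j => exact .var x

theorem inScope {g : ℕ → ℕ} {M M' : Tm B} (h : Par M M') (hM : M.InScope g) :
    M'.InScope g := by
  induction h generalizing g with
  | var x => exact hM
  | lam T _ ih => exact ih hM
  | app _ _ ih₁ ih₂ => exact ⟨ih₁ hM.1, ih₂ hM.2⟩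
  | quo Δ _ ih => exact ih hM
  | unq n _ _ ih₁ ih₂ => exact ⟨ih₁ hM.1, fun i => ih₂ i (hM.2 i)⟩
  | beta T _ _ ih₁ ih₂ => exact Tm.InScope.beta (ih₁ hM.1) (ih₂ hM.2)
  | unquote n Δ _ _ ih₁ ih₂ => exact Tm.InScope.unquote (ih₁ hM.1) fun i => ih₂ i (hM.2 i)

/-- Every term has a complete development. -/
theorem exists_development (M : Tm B) : ∃ D, ∀ M', Par M M' → Par M' D := by
  induction M with
  | var x => exact ⟨_, fun M' h => by cases h; exact .var x⟩
  | lam T M ih =>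
    obtain ⟨D, hD⟩ := ih
    refine ⟨.lam T D, fun M' h => ?_⟩
    cases h with
    | lam _ h => exact .lam T (hD _ h)
  | app M N ih₁ ih₂ =>
    obtain ⟨D, hD⟩ := ih₁
    obtain ⟨E, hE⟩ := ih₂
    by_cases hM : ∃ T P, M = .lam T P
    · obtain ⟨T, P, rfl⟩ := hM
      -- By reflexivity `D` is itself a parallel reduct of the abstraction, hence an abstraction,
      -- and its body `Q` is a development of `P`.
      obtain ⟨Q, rfl⟩ : ∃ Q, D = .lam T Q := by
        cases hD _ (.refl _) with
        | lam _ h => exact ⟨_, rfl⟩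
      have hQ : ∀ P', Par P P' → Par P' Q := fun P' h => by
        cases hD _ (.lam T h) with
        | lam _ h => exact h
      refine ⟨Q.ksub (.plug 1 (inst fun _ : Fin 1 => E)), fun M' h => ?_⟩
      cases h with
      | app h₁ h₂ =>
        cases h₁ with
        | lam _ h₁ => exact .beta T (hQ _ h₁) (hE _ h₂)
      | beta _ h₁ h₂ => exact plug_inst (hQ _ h₁) (hE _ h₂)
    · refine ⟨.app D E, fun M' h => ?_⟩
      cases h with
      | app h₁ h₂ => exact .app (hD _ h₁) (hE _ h₂)
      | beta T h₁ h₂ => exact absurd ⟨_, _, rfl⟩ hM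
  | quo Δ M ih =>
    obtain ⟨D, hD⟩ := ih
    refine ⟨.quo Δ D, fun M' h => ?_⟩
    cases h with
    | quo _ h => exact .quo Δ (hD _ h)
  | @unq k n M N ih₁ ih₂ =>
    obtain ⟨D, hD⟩ := ih₁
    choose E hE using ih₂
    by_cases hM : ∃ (Δ : Fin k → Ty B) (P : Tm B), M = .quo Δ P
    · obtain ⟨Δ, P, rfl⟩ := hM
      obtain ⟨Q, rfl⟩ : ∃ Q, D = .quo Δ Q := by
        cases hD _ (.refl _) with
        | quo _ h => exact ⟨_, rfl⟩
      have hQ : ∀ P', Par P P' → Par P' Q := fun P' h => by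
        cases hD _ (.quo Δ h) with
        | quo _ h => exact h
      refine ⟨Q.ksub (.plug n (instClosed E)), fun M' h => ?_⟩
      cases h with
      | unq _ h₁ h₂ =>
        cases h₁ with
        | quo _ h₁ => exact .unquote n Δ (hQ _ h₁) fun i => hE i _ (h₂ i)
      | unquote _ _ h₁ h₂ => exact plug_instClosed (hQ _ h₁) fun i => hE i _ (h₂ i)
    · refine ⟨.unq n D E, fun M' h => ?_⟩
      cases h with
      | unq _ h₁ h₂ => exact .unq n (hD _ h₁) fun i => hE i _ (h₂ i)
      | unquote _ Δ h₁ h₂ => exact absurd ⟨_, _, rfl⟩ hM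

end Par

theorem KStep.par {M M' : Tm B} (h : KStep M M') : Par M M' := by
  induction h with
  | beta T M N => exact .beta T (.refl M) (.refl N)
  | unquote n Δ M N => exact .unquote n Δ (.refl M) fun i => .refl (N i)
  | lam T _ ih => exact .lam T ih
  | appL N _ ih => exact .app ih (.refl N)
  | appR M _ ih => exact .app (.refl M) ih
  | quo Δ _ ih => exact .quo Δ ih
  | unqL n N _ ih => exact .unq n ih fun i => .refl (N i)
  | unqR n M N i _ ih =>
    refine .unq n (.refl M) fun j => ?_
    by_cases hj : j = i
    · subst hj
      simpa using ih
    · simpa [hj] using Par.refl (N j)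

/-! ### Comparison of parallel reduction with `Steps` -/

theorem Steps.lam (T : Ty B) {M M' : Tm B} (h : Steps M M') : Steps (.lam T M) (.lam T M') :=
  h.lift _ fun _ _ => .lam T

theorem Steps.app {M M' N N' : Tm B} (hM : Steps M M') (hN : Steps N N') :
    Steps (.app M N) (.app M' N') :=
  (hM.lift (Tm.app · N) fun _ _ => .appL N).trans (hN.lift (Tm.app M' ·) fun _ _ => .appR M')

theorem Steps.quo {k : ℕ} (Δ : Fin k → Ty B) {M M' : Tm B} (h : Steps M M') :
    Steps (.quo Δ M) (.quo Δ M') :=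
  h.lift _ fun _ _ => .quo Δ

theorem Steps.unq_update {k : ℕ} (n : ℕ) (M : Tm B) (N : Fin k → Tm B) (i : Fin k) {L : Tm B}
    (h : Steps (N i) L) : Steps (.unq n M N) (.unq n M (Function.update N i L)) := by
  induction h with
  | refl => rw [Function.update_eq_self]
  | @tail L L' _ h ih =>
    have := Step.unqR n M (Function.update N i L) i (L := L') (by simpa using h)
    rw [Function.update_idem] at this
    exact ih.tail this

theorem Steps.unq {k : ℕ} (n : ℕ) {M M' : Tm B} {N N' : Fin k → Tm B} (hM : Steps M M')
    (hN : ∀ i, Steps (N i) (N' i)) : Steps (.unq n M N) (.unq n M' N') := by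
  refine (hM.lift (Tm.unq n · N) fun _ _ => .unqL n N).trans ?_
  -- The entries are reduced one at a time; `s` is the set of those already done.
  have key : ∀ s : Finset (Fin k), Steps (.unq n M' N) (.unq n M' (s.piecewise N' N)) := by
    intro s
    induction s using Finset.induction_on with
    | empty => simpa using Relation.ReflTransGen.refl
    | insert i s hi ih =>
      rw [Finset.piecewise_insert]
      exact ih.trans (unq_update n M' _ i (by simpa [hi] using hN i))
  simpa using key Finset.univ

theorem Par.steps {g : ℕ → ℕ} {M M' : Tm B} (h : Par M M') (hM : M.InScope g) :
    Steps M M' := by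
  induction h generalizing g with
  | var x => exact .refl
  | lam T _ ih => exact .lam T (ih hM)
  | app _ _ ih₁ ih₂ => exact .app (ih₁ hM.1) (ih₂ hM.2)
  | quo Δ _ ih => exact .quo Δ (ih hM)
  | unq n _ _ ih₁ ih₂ => exact .unq n (ih₁ hM.1) fun i => ih₂ i (hM.2 i)
  | @beta T M M' N N' _ _ ih₁ ih₂ =>
    refine (Steps.app (.lam T (ih₁ hM.1)) (ih₂ hM.2)).tail ?_
    rw [← Tm.subst_one_eq_ksub_plug]
    exact .beta T M' N'
  | @unquote k n Δ M M' N N' h _ ih₁ ih₂ =>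
    refine (Steps.unq n (.quo Δ (ih₁ hM.1)) fun i => ih₂ i (hM.2 i)).tail ?_
    -- Inner reductions keep the body in scope, so at this point `inst` and `instClosed` give the
    -- same contractum.
    rw [← Tm.InScope.ksub_plug_inst (h.inScope hM.1), ← Tm.lev_subst_eq_ksub_plug]
    exact .unquote n Δ M' N'

theorem Steps.par {g : ℕ → ℕ} {M M' : Tm B} (h : Steps M M') (hM : M.InScope g) :
    Relation.ReflTransGen Par M M' ∧ M'.InScope g := by
  induction h with
  | refl => exact ⟨.refl, hM⟩
  | tail _ h ih =>
    have h' := h.kStep ih.2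
    exact ⟨ih.1.tail h'.par, h'.inScope ih.2⟩

theorem Par.manySteps {g : ℕ → ℕ} {M M' : Tm B} (h : Relation.ReflTransGen Par M M')
    (hM : M.InScope g) : Steps M M' := by
  have : Steps M M' ∧ M'.InScope g := by
    induction h with
    | refl => exact ⟨.refl, hM⟩
    | tail _ h ih => exact ⟨ih.1.trans (h.steps ih.2), h.inScope ih.2⟩
  exact this.1

theorem Tm.InScope.confluent {g : ℕ → ℕ} {M : Tm B} (hM : M.InScope g) : Confluent M := by
  intro N₁ N₂ h₁ h₂
  obtain ⟨h₁, hN₁⟩ := h₁.par hM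
  obtain ⟨h₂, hN₂⟩ := h₂.par hM
  obtain ⟨L, hL₁, hL₂⟩ := Relation.church_rosser (fun M P Q hP hQ => by
    obtain ⟨D, hD⟩ := Par.exists_development M
    exact ⟨D, .single (hD P hP), .single (hD Q hQ)⟩) h₁ h₂
  exact ⟨L, Par.manySteps hL₁ hN₁, Par.manySteps hL₂ hN₂⟩

theorem Confluent.weaklyConfluent {M : Tm B} (h : Confluent M) : WeaklyConfluent M :=
  fun N₁ N₂ h₁ h₂ => h N₁ N₂ (.single h₁) (.single h₂)

end FitchContextual

theorem mainTheorem2 {B : Type*} :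
    (∀ (A : FitchContextual.Variant) (Ψ : FitchContextual.Stack B) (M : FitchContextual.Tm B)
        (T : FitchContextual.Ty B),
      FitchContextual.HasType A Ψ M T → FitchContextual.StronglyNormalizing M) ∧
    (∀ (s : List ℕ) (M : FitchContextual.Tm B),
      FitchContextual.Scoped s M → FitchContextual.WeaklyConfluent M) ∧
    (∀ (s : List ℕ) (M : FitchContextual.Tm B),
      FitchContextual.Scoped s M → FitchContextual.Confluent M) :=
  ⟨fun _ _ _ _ h => h.sn.stronglyNormalizing h.scoped.inScope,
    fun _ _ h => h.inScope.confluent.weaklyConfluent, fun _ _ h => h.inScope.confluent⟩
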